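/- Let $(W,S)$ be a Coxeter system with $S$ finite, let $|w|$ denote word length with respect to $S$, and let $i:S\to I$ be a function into a set $I$ such that $i(s)=i(s')$ whenever $s,s'\in S$ are conjugate in $W$. Let $\mathbf t=(t_i)_{i\in I}$ be commuting indeterminates. For $w\in W$ put $t^w=\prod_{j=1}^n t_{i(s_j)}$, where $w=s_1\cdots s_n$ is a reduced expression (the monomial does not depend on its choice), and define the standard growth series and the complete growth series $$\gamma(\mathbf t)=\sum_{w\in W}t^w\in\mathbb Q[[\mathbf t]],\qquad \tilde\gamma(\mathbf t)=\sum_{w\in W}w\,t^w\in\mathbb Q[W][[\mathbf t]].$$ A power series in $R[[\mathbf t]]$ ($R=\mathbb Q$ or $R=\mathbb Q[W]$) is called rational if it can be obtained from finitely many polynomials in $R[\mathbf t]$ by a finite sequence of additions, multiplications and quasi-inversions $\lambda\mapsto\lambda^+=\sum_{k\ge1}\lambda^k$ of series $\lambda$ with zero constant term. Let $\mathcal A$ be the set of nonempty subsets $\sigma\subseteq S$ that generate a finite subgroup $W_\sigma$ of $W$, let $w_\sigma$ be the element of longest length in $W_\sigma$, and let $\mathbb Q\langle\langle\mathcal A\rangle\rangle$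 be the $\mathbb Q$-algebra of formal power series in noncommuting variables $\sigma\in\mathcal A$. Let $\mathcal L\subseteq\mathcal A^*$ be the left greedy normal form of $W$, i.e. the set of words $\sigma_n\cdots\sigma_1$ ($n\ge0$) such that, for each $1\le j\le n$, $\sigma_j$ is the left descent set $\{s\in S: |sv_j|<|v_j|\}$ of $v_j=w_{\sigma_j}w_{\sigma_{j-1}}\cdots w_{\sigma_1}$. Let $\chi=\sum_{\alpha\in\mathcal L}\alpha$ be its characteristic series. Then $\gamma(\mathbf t)$ and $\tilde\gamma(\mathbf t)$ are both rational. Moreover, the substitutions $\sigma\mapsto t^{w_\sigma}$ and $\sigma\mapsto w_\sigma t^{w_\sigma}$ (extended to infinite series by $\sum_\alpha r_\alpha\alpha\mapsto\sum_\alpha r_\alpha\,\phi(\alpha)$, respectively $\sum_\alpha r_\alpha\tilde\phi(\alpha)$, coefficientwise) define $\mathbb Q$-algebra homomorphisms $$\phi:\mathbb Q\langle\langle\mathcal A\rangle\rangle\to\mathbb Q[[\mathbf t]],\qquad \tilde\phi:\mathbb Q\langle\langle\mathcal A\rangle\rangle\to\mathbb Q[W][[\mathbf t]],$$ and $\phi(\chi)=\gamma(\mathbf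 t)$, $\tilde\phi(\chi)=\tilde\gamma(\mathbf t)$. -/

import Mathlib

/-! ### Noncommutative formal power series over `ℚ` -/

/-- The underlying type of the ring `ℚ⟪A⟫` of formal power series in the noncommuting letters of
the alphabet `A`: the value of a series at a word is the coefficient of that word. -/
def NCPowerSeries (A : Type*) : Type _ := List A → ℚ

namespace NCPowerSeries

variable {A : Type*}

noncomputable instance : AddCommGroup (NCPowerSeries A) :=
  inferInstanceAs (AddCommGroup (List A → ℚ))

noncomputable instance : Module ℚ (NCPowerSeries A) :=
  inferInstanceAs (Module ℚ (List A → ℚ))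

/-- The coefficient of the word `α` in the series `l`. -/
def coeff (α : List A) (l : NCPowerSeries A) : ℚ := l α

@[ext] theorem ext {l m : NCPowerSeries A} (h : ∀ α, coeff α l = coeff α m) : l = m :=
  funext h

@[simp] theorem coeff_zero (α : List A) : coeff α (0 : NCPowerSeries A) = 0 := rfl

@[simp] theorem coeff_add (α : List A) (l m : NCPowerSeries A) :
    coeff α (l + m) = coeff α l + coeff α m := rfl

@[simp] theorem coeff_smul (α : List A) (c : ℚ) (l : NCPowerSeries A) :
    coeff α (c • l) = c * coeff α l := rfl

instance : One (NCPowerSeries A) :=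
  ⟨fun α => match α with
    | [] => 1
    | _ :: _ => 0⟩

/-- The product: the coefficient of `α` in `l * m` is the sum, over all factorizations
`α = β γ`, of the coefficient of `β` in `l` times the coefficient of `γ` in `m`. -/
noncomputable instance : Mul (NCPowerSeries A) :=
  ⟨fun l m α => ∑ k ∈ Finset.range (α.length + 1), coeff (α.take k) l * coeff (α.drop k) m⟩

theorem coeff_mul (α : List A) (l m : NCPowerSeries A) :
    coeff α (l * m) =
      ∑ k ∈ Finset.range (α.length + 1), coeff (α.take k) l * coeff (α.drop k) m := rfl

@[simp] theorem coeff_nil_one : coeff [] (1 : NCPowerSeries A) = 1 :=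
  rfl

@[simp] theorem coeff_cons_one (a : A) (α : List A) :
    coeff (a :: α) (1 : NCPowerSeries A) = 0 :=
  rfl

/-- The series of all words `α` with the coefficient of `a α` in `l`. -/
def shift (a : A) (l : NCPowerSeries A) : NCPowerSeries A := fun α => l (a :: α)

theorem coeff_shift (a : A) (α : List A) (l : NCPowerSeries A) :
    coeff α (shift a l) = coeff (a :: α) l := rfl

theorem coeff_nil_mul (l m : NCPowerSeries A) :
    coeff [] (l * m) = coeff [] l * coeff [] m := by
  simp [coeff_mul]

theorem coeff_cons_mul (a : A) (α : List A) (l m : NCPowerSeries A) :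
    coeff (a :: α) (l * m) =
      coeff α (shift a l * m) + coeff [] l * coeff (a :: α) m := by
  simp only [coeff_mul, List.length_cons, coeff_shift]
  rw [Finset.sum_range_succ']
  simp

protected theorem add_mul' (l m p : NCPowerSeries A) : (l + m) * p = l * p + m * p := by
  ext α
  simp [coeff_mul, add_mul, Finset.sum_add_distrib]

protected theorem mul_add' (l m p : NCPowerSeries A) : l * (m + p) = l * m + l * p := by
  ext α
  simp [coeff_mul, mul_add, Finset.sum_add_distrib]

protected theorem smul_mul' (c : ℚ) (l m : NCPowerSeries A) : (c • l) * m = c • (l * m) := by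
  ext α
  simp [coeff_mul, mul_assoc, Finset.mul_sum]

protected theorem mul_smul' (c : ℚ) (l m : NCPowerSeries A) : l * (c • m) = c • (l * m) := by
  ext α
  simp [coeff_mul, mul_left_comm, Finset.mul_sum]

theorem shift_mul (a : A) (l m : NCPowerSeries A) :
    shift a (l * m) = shift a l * m + coeff [] l • shift a m := by
  ext α
  simp [coeff_shift, coeff_cons_mul]

protected theorem mul_assoc' (l m p : NCPowerSeries A) : l * m * p = l * (m * p) := by
  ext α
  induction α generalizing l with
  | nil => simp [coeff_nil_mul, mul_assoc]
  | cons a α ih =>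
    rw [coeff_cons_mul, shift_mul, NCPowerSeries.add_mul', coeff_add, ih,
      NCPowerSeries.smul_mul', coeff_smul, coeff_nil_mul, coeff_cons_mul a α l,
      coeff_cons_mul a α m]
    ring

protected theorem zero_mul' (l : NCPowerSeries A) : 0 * l = 0 := by
  ext α
  simp [coeff_mul]

protected theorem mul_zero' (l : NCPowerSeries A) : l * 0 = 0 := by
  ext α
  simp [coeff_mul]

protected theorem one_mul' (l : NCPowerSeries A) : 1 * l = l := by
  ext α
  cases α with
  | nil => simp [coeff_nil_mul]
  | cons a α =>
    have h : shift a (1 : NCPowerSeries A) = 0 := by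
      ext β
      simp [coeff_shift]
    simp [coeff_cons_mul, h, NCPowerSeries.zero_mul']

protected theorem mul_one' (l : NCPowerSeries A) : l * 1 = l := by
  ext α
  induction α generalizing l with
  | nil => simp [coeff_nil_mul]
  | cons a α ih => simp [coeff_cons_mul, ih, coeff_shift]

noncomputable instance : Ring (NCPowerSeries A) where
  __ := (inferInstance : AddCommGroup (NCPowerSeries A))
  left_distrib := NCPowerSeries.mul_add'
  right_distrib := NCPowerSeries.add_mul'
  zero_mul := NCPowerSeries.zero_mul'
  mul_zero := NCPowerSeries.mul_zero'
  mul_assoc := NCPowerSeries.mul_assoc'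
  one_mul := NCPowerSeries.one_mul'
  mul_one := NCPowerSeries.mul_one'

noncomputable instance : Algebra ℚ (NCPowerSeries A) :=
  Algebra.ofModule NCPowerSeries.smul_mul' NCPowerSeries.mul_smul'

open scoped Classical in
/-- The characteristic series `∑_{α ∈ L} α` of a language `L` over `A`. -/
noncomputable def charSeries (L : Language A) : NCPowerSeries A :=
  fun α => if α ∈ L then 1 else 0

/-- The letter `a`, as a power series. -/
noncomputable def letter (a : A) : NCPowerSeries A := charSeries ({[a]} : Set (List A))

end NCPowerSeries

/-! ### Power series in commuting variables and rationality -/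

/-- The sum of a family `f` of power series in commuting variables, formed coefficient by
coefficient. It is used for families in which, for every monomial, only finitely many members have
a nonzero coefficient at that monomial. -/
noncomputable def MvPowerSeries.formalSum {I R ι : Type*} [Semiring R]
    (f : ι → MvPowerSeries I R) : MvPowerSeries I R :=
  fun n => ∑ᶠ j, MvPowerSeries.coeff n (f j)

/-- The quasi-inverse `p⁺ = ∑_{k ≥ 1} p ^ k` of a power series `p` with zero constant term. -/
noncomputable def MvPowerSeries.quasiInverse {I R : Type*} [Semiring R]
    (p : MvPowerSeries I R) : MvPowerSeries I R :=
  MvPowerSeries.formalSum fun k : ℕ => p ^ (k + 1)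

/-- A power series (in commuting variables, over a possibly noncommutative coefficient ring) is
rational if it can be obtained from polynomials by finitely many additions, multiplications and
quasi-inversions (the latter of series with zero constant term). -/
inductive MvPowerSeries.IsRational {I R : Type*} [Semiring R] : MvPowerSeries I R → Prop
  | polynomial (p : MvPowerSeries I R)
      (hp : {n : I →₀ ℕ | MvPowerSeries.coeff n p ≠ 0}.Finite) : IsRational p
  | add (p q : MvPowerSeries I R) : IsRational p → IsRational q → IsRational (p + q)
  | mul (p q : MvPowerSeries I R) : IsRational p → IsRational q → IsRational (p * q)
  | quasiInverse (p : MvPowerSeries I R) (h0 : MvPowerSeries.constantCoeff p = 0) :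
      IsRational p → IsRational p.quasiInverse

/-- The value at `l` of the substitution `a ↦ f a`: the series `∑_α l_α f(a₁) ⋯ f(aₖ)`, where
`α = a₁ ⋯ aₖ` runs over all words and `l_α` is the coefficient of `α` in `l`. -/
noncomputable def NCPowerSeries.subst {A I R : Type*} [Semiring R] [Algebra ℚ R]
    (f : A → MvPowerSeries I R) (l : NCPowerSeries A) : MvPowerSeries I R :=
  MvPowerSeries.formalSum fun α : List A => NCPowerSeries.coeff α l • (α.map f).prod

/-! ### Coxeter systems: nerve, greedy normal form and growth series -/

namespace CoxeterSystem

variable {B : Type*} {W : Type*} [Group W] {M : CoxeterMatrix B} (cs : CoxeterSystem M W)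

/-- The subgroup `W_σ` generated by the simple reflections in `σ`. -/
def parabolic (σ : Set B) : Subgroup W := Subgroup.closure (cs.simple '' σ)

/-- The proper nerve: the set of all nonempty subsets `σ` of the set of generators for which the
subgroup `W_σ` is finite. -/
def ProperNerve : Type _ :=
  {σ : Set B // σ.Nonempty ∧ (cs.parabolic σ : Set W).Finite}

theorem exists_longest (σ : cs.ProperNerve) :
    ∃ w ∈ cs.parabolic σ.1, ∀ u ∈ cs.parabolic σ.1, cs.length u ≤ cs.length w :=
  Set.exists_max_image (cs.parabolic σ.1 : Set W) cs.length σ.2.2 ⟨1, one_mem _⟩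

/-- The element `w_σ` of longest length in the finite group `W_σ`. -/
noncomputable def longest (σ : cs.ProperNerve) : W := (cs.exists_longest σ).choose

/-- The left descent set of `w`. -/
def leftDescentSet (w : W) : Set B := {s | cs.IsLeftDescent w s}

/-- The element `π(α) = w_{σ_n} ⋯ w_{σ_1}` for the word `α = σ_n ⋯ σ_1` over the proper nerve. -/
noncomputable def nerveProd (α : List cs.ProperNerve) : W := (α.map cs.longest).prod

/-- The left greedy normal form: the language of all words `σ_n ⋯ σ_1` over the proper nerve such
that `σ_i` is the left descent set of `w_{σ_i} ⋯ w_{σ_1}` for all `i`. (The words `σ_i ⋯ σ_1` with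
`i ≥ 1` are the nonempty suffixes.) -/
def greedyNormalForm : Language cs.ProperNerve :=
  {α | ∀ (σ : cs.ProperNerve) (β : List cs.ProperNerve),
    (σ :: β) <:+ α → σ.1 = cs.leftDescentSet (cs.nerveProd (σ :: β))}

/-- A reduced word for `w`. -/
noncomputable def reducedWord (w : W) : List B := (cs.exists_isReduced w).choose

/-- The exponent of the monomial `t^w = t_{i(s_1)} ⋯ t_{i(s_n)}`, where `s_1 ⋯ s_n` is a reduced
expression for `w`. When `i` is constant on conjugacy classes of generators, this does not depend
on the reduced expression. -/
noncomputable def growthExponent {I : Type*} (i : B → I) (w : W) : I →₀ ℕ :=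
  ((cs.reducedWord w).map fun s => Finsupp.single (i s) 1).sum

/-- The monomial `t^w` in `ℚ[[t]]`. -/
noncomputable def growthMonomial {I : Type*} (i : B → I) (w : W) : MvPowerSeries I ℚ :=
  MvPowerSeries.monomial (cs.growthExponent i w) 1

/-- The monomial `w t^w` in `ℚ[W][[t]]`. -/
noncomputable def completeGrowthMonomial {I : Type*} (i : B → I) (w : W) :
    MvPowerSeries I (MonoidAlgebra ℚ W) :=
  MvPowerSeries.monomial (cs.growthExponent i w) (MonoidAlgebra.of ℚ W w)

/-- The standard growth series `γ(t) = ∑_{w ∈ W} t^w`. -/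
noncomputable def growthSeries {I : Type*} (i : B → I) : MvPowerSeries I ℚ :=
  MvPowerSeries.formalSum fun w : W => cs.growthMonomial i w

/-- The standard complete growth series `γ̃(t) = ∑_{w ∈ W} w t^w`. -/
noncomputable def completeGrowthSeries {I : Type*} (i : B → I) :
    MvPowerSeries I (MonoidAlgebra ℚ W) :=
  MvPowerSeries.formalSum fun w : W => cs.completeGrowthMonomial i w

end CoxeterSystem

/-!
Everything is proved for the series `∑_w ρ(w) t^w` attached to a representation `ρ : W →* R` in a
ring `R`; the trivial representation in `ℚ` gives `γ`, and `MonoidAlgebra.of` gives `γ̃`.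

*Inversions.* Letting a simple reflection `s` act on `W × ℤ/2` by `(t, ε) ↦ (s t s, ε + [t = s])`
respects the Coxeter relations. The second coordinate of the resulting action of `W` detects right
inversions, so the inversion set of `u v` is the symmetric difference of that of `v` and a conjugate
of that of `u` (`isRightInversion_mul_iff`), and a right inversion of an element occurs in the right
inversion sequence of every word for it (`mem_rightInvSeq_of_isRightInversion`). Hence the exponent
of `t^w` is a sum over the inversions of `w`; it can be computed from any reduced word, and it is
additive on products along which lengths add (`growthExponent_mul`).

*Parabolic subgroups.* If `u` has no right descent in `T`, then `ℓ (u v) = ℓ u + ℓ v` for all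
`v ∈ W_T` (`length_mul_of_forall_not_isRightDescent`), and every element of `W` is such a product
`u v` in exactly one way. If on the contrary all elements of `T` are right descents of `w`, then
`ℓ w = ℓ (w x⁻¹) + ℓ x` for all `x ∈ W_T` (`length_eq_add_of_forall_isRightDescent`), so that `W_T`
is finite.

*Rationality.* Write `G_T` for the series of `W_T`, and `G_T^U` for that of the elements of `W_T`
without right descents in `U ⊆ T`; then `G_T = G_T^U G_U`. If `W_T` is infinite, then
no element of `W_T` has all of `T` as right descents, so by inclusion and exclusion
`∑_{U ⊆ T} (-1)^|U| G_T^U = 0`, that is, `∑_{U ⊆ T} (-1)^|U| G_U⁻¹ = 0`. This expresses `G_T⁻¹`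
by the series `G_U⁻¹` with `U ⊊ T`, while `G_T` is a polynomial if `W_T` is finite. As
`p⁻¹ = 1 + (1 - p)⁺` for series with constant term `1`, all `G_T⁻¹` and all `G_T` are rational, by
induction on `T`.

*Normal forms.* A word `σ_n ⋯ σ_1` of `ℒ` can be recovered from its product `w`: the letter `σ_n`
is the left descent set of `w`, and lengths add in `w = w_{σ_n} (w_{σ_n}⁻¹ w)`. Conversely, the
left descent set of any `w ≠ 1` generates a finite subgroup, so splitting off longest elements
produces a word for `w`. Thus `ℒ → W` is bijective and compatible with exponents, which gives
`φ(χ) = γ` for the substitution `φ`. The latter is an algebra homomorphism because the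
alphabet is finite and letters go to series without constant term, so that only finitely many words
contribute to each coefficient.
-/

/-! ### The reflection cocycle and the strong exchange property -/

namespace CoxeterSystem

variable {B W : Type*} [Group W] {M : CoxeterMatrix B} (cs : CoxeterSystem M W)

open scoped Classical in
/-- The self-map `(t, ε) ↦ (s t s, ε + [t = s])` of `W × ℤ/2` attached to a simple reflection
`s`. -/
noncomputable def signedConj (s : B) : Function.End (W × ZMod 2) :=
  fun p => (cs.simple s * p.1 * cs.simple s, p.2 + if p.1 = cs.simple s then 1 else 0)

theorem simple_mul_mul_simple_eq_iff (s : B) (t u : W) :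
    cs.simple s * t * cs.simple s = u ↔ t = cs.simple s * u * cs.simple s := by
  constructor <;> rintro rfl <;> simp [mul_assoc]

theorem simple_mul_pow_mul_simple (s s' : B) (k : ℕ) :
    cs.simple s' * (cs.simple s * cs.simple s') ^ k =
      ((cs.simple s * cs.simple s') ^ k)⁻¹ * cs.simple s' := by
  have h : cs.simple s' * (cs.simple s * cs.simple s') =
      (cs.simple s * cs.simple s')⁻¹ * cs.simple s' := by simp [mul_assoc]
  rw [← inv_pow]
  exact SemiconjBy.pow_right h k

open scoped Classical in
/-- The reflections met by the `k`-fold iterate of `s s'` are the `2 k` elements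
`s' (s s') ^ l` with `l < 2 k`. -/
theorem signedConj_mul_pow_apply (s s' : B) (k : ℕ) (t : W) (ε : ZMod 2) :
    ((cs.signedConj s * cs.signedConj s') ^ k) (t, ε) =
      ((cs.simple s * cs.simple s') ^ k * t * ((cs.simple s * cs.simple s') ^ k)⁻¹,
        ε + ∑ l ∈ Finset.range (2 * k),
          if t = cs.simple s' * (cs.simple s * cs.simple s') ^ l then 1 else 0) := by
  induction k with
  | zero => simp; rfl
  | succ k ih =>
    set c := cs.simple s * cs.simple s' with hc
    have hcomm := cs.simple_mul_pow_mul_simple s s' k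
    rw [← hc] at hcomm
    have e1 : c ^ k * t * (c ^ k)⁻¹ = cs.simple s' ↔ t = cs.simple s' * c ^ (2 * k) := by
      rw [two_mul, pow_add, ← mul_assoc, hcomm, mul_inv_eq_iff_eq_mul,
        mul_assoc _ _ (c ^ k), eq_inv_mul_iff_mul_eq]
    have e2 : cs.simple s' * (c ^ k * t * (c ^ k)⁻¹) * cs.simple s' = cs.simple s ↔
        t = cs.simple s' * c ^ (2 * k + 1) := by
      rw [simple_mul_mul_simple_eq_iff, show 2 * k + 1 = k + (1 + k) by ring, pow_add, ← mul_assoc,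
        hcomm, mul_inv_eq_iff_eq_mul, mul_assoc _ _ (c ^ (1 + k)), eq_inv_mul_iff_mul_eq, pow_add,
        pow_one]
      simp [mul_assoc, hc]
    rw [pow_succ']
    change cs.signedConj s (cs.signedConj s'
      (((cs.signedConj s * cs.signedConj s') ^ k) (t, ε))) = _
    rw [ih]
    simp only [signedConj]
    rw [show 2 * (k + 1) = 2 * k + 1 + 1 by ring, Finset.sum_range_succ, Finset.sum_range_succ]
    simp only [e1, e2, Prod.mk.injEq]
    refine ⟨?_, by ring⟩
    rw [pow_succ']
    simp [mul_assoc, hc]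

theorem isLiftable_signedConj : M.IsLiftable cs.signedConj := by
  classical
  intro s s'
  refine funext fun ⟨t, ε⟩ => ?_
  rw [signedConj_mul_pow_apply, two_mul, Finset.sum_range_add]
  simp only [pow_add, simple_mul_simple_pow, one_mul, CharTwo.add_self_eq_zero, add_zero,
    inv_one, mul_one]
  rfl

/-- The action of `W` on `W × ℤ/2` extending `signedConj`. -/
noncomputable def signedConjHom : W →* Function.End (W × ZMod 2) :=
  cs.lift ⟨cs.signedConj, cs.isLiftable_signedConj⟩

/-- The reflection cocycle: for a word `ω`, the value at `(π ω, t)` is the parity of the number of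
occurrences of `t` in the right inversion sequence of `ω`. -/
noncomputable def reflectionCocycle (w t : W) : ZMod 2 := (cs.signedConjHom w (t, 0)).2

theorem signedConjHom_simple (s : B) : cs.signedConjHom (cs.simple s) = cs.signedConj s :=
  cs.lift_apply_simple _ s

open scoped Classical in
theorem signedConjHom_wordProd (ω : List B) (t : W) (ε : ZMod 2) :
    cs.signedConjHom (cs.wordProd ω) (t, ε) =
      (cs.wordProd ω * t * (cs.wordProd ω)⁻¹, ε + ((cs.rightInvSeq ω).count t : ℕ)) := by
  induction ω with
  | nil => simp; rfl
  | cons s ω ih =>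
    have e : cs.wordProd ω * t * (cs.wordProd ω)⁻¹ = cs.simple s ↔
        (cs.wordProd ω)⁻¹ * cs.simple s * cs.wordProd ω = t := by
      constructor
      · intro h; rw [← h]; group
      · rintro rfl; group
    rw [wordProd_cons, map_mul, signedConjHom_simple]
    change cs.signedConj s (cs.signedConjHom (cs.wordProd ω) (t, ε)) = _
    rw [ih]
    simp only [signedConj, rightInvSeq, List.count_cons, e, beq_iff_eq, Prod.mk.injEq]
    refine ⟨by simp [mul_assoc], ?_⟩
    push_cast
    ring

open scoped Classical in
theorem reflectionCocycle_wordProd (ω : List B) (t : W) :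
    cs.reflectionCocycle (cs.wordProd ω) t = ((cs.rightInvSeq ω).count t : ℕ) := by
  simp [reflectionCocycle, signedConjHom_wordProd]

theorem signedConjHom_apply (w t : W) (ε : ZMod 2) :
    cs.signedConjHom w (t, ε) = (w * t * w⁻¹, ε + cs.reflectionCocycle w t) := by
  classical
  obtain ⟨ω, rfl⟩ := cs.wordProd_surjective w
  rw [signedConjHom_wordProd, reflectionCocycle_wordProd]

theorem reflectionCocycle_mul (u v t : W) :
    cs.reflectionCocycle (u * v) t =
      cs.reflectionCocycle v t + cs.reflectionCocycle u (v * t * v⁻¹) := by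
  have h : cs.signedConjHom (u * v) (t, 0) = cs.signedConjHom u (cs.signedConjHom v (t, 0)) := by
    rw [map_mul]; rfl
  simp only [signedConjHom_apply] at h
  simpa using congrArg Prod.snd h

theorem reflectionCocycle_self {t : W} (ht : cs.IsReflection t) :
    cs.reflectionCocycle t t = 1 := by
  classical
  obtain ⟨u, s, rfl⟩ := ht
  have h1 : cs.reflectionCocycle (cs.simple s) (cs.simple s) = 1 := by
    simpa using cs.reflectionCocycle_wordProd [s] (cs.simple s)
  have h2 : cs.reflectionCocycle (u * u⁻¹) (u * cs.simple s * u⁻¹) = 0 := by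
    simpa using cs.reflectionCocycle_wordProd [] (u * cs.simple s * u⁻¹)
  rw [reflectionCocycle_mul] at h2 ⊢
  rw [reflectionCocycle_mul]
  simp only [mul_assoc, inv_inv, inv_mul_cancel, mul_one, inv_mul_cancel_left,
    one_mul, h1, inv_simple, simple_mul_simple_self] at h2 ⊢
  rw [add_left_comm, h2, add_zero]

theorem isRightInversion_of_reflectionCocycle {w t : W} (h : cs.reflectionCocycle w t = 1) :
    cs.IsRightInversion w t := by
  classical
  obtain ⟨ω, hω, rfl⟩ := cs.exists_isReduced w
  refine cs.isRightInversion_of_mem_rightInvSeq hω ?_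
  by_contra hmem
  rw [reflectionCocycle_wordProd, List.count_eq_zero_of_not_mem hmem] at h
  simp at h

theorem reflectionCocycle_eq_one_iff {w t : W} (ht : cs.IsReflection t) :
    cs.reflectionCocycle w t = 1 ↔ cs.IsRightInversion w t := by
  refine ⟨cs.isRightInversion_of_reflectionCocycle, fun h => ?_⟩
  by_contra h0
  have h1 : cs.reflectionCocycle (w * t) t = 1 := by
    rw [reflectionCocycle_mul, cs.reflectionCocycle_self ht, mul_inv_cancel_right]
    generalize cs.reflectionCocycle w t = x at h0
    revert x
    decide
  exact ht.isRightInversion_mul_left_iff.1 (cs.isRightInversion_of_reflectionCocycle h1) h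

/-- The inversion set of a product is the symmetric difference of the inversion set of the right
factor and a conjugate of the inversion set of the left factor. -/
theorem isRightInversion_mul_iff {u v t : W} (ht : cs.IsReflection t) :
    cs.IsRightInversion (u * v) t ↔
      (cs.IsRightInversion v t ↔ ¬ cs.IsRightInversion u (v * t * v⁻¹)) := by
  rw [← cs.reflectionCocycle_eq_one_iff ht, ← cs.reflectionCocycle_eq_one_iff ht,
    ← cs.reflectionCocycle_eq_one_iff (ht.conj v), reflectionCocycle_mul]
  generalize cs.reflectionCocycle v t = x
  generalize cs.reflectionCocycle u (v * t * v⁻¹) = y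
  revert x y
  decide

/-- The strong exchange property, for words that need not be reduced. -/
theorem mem_rightInvSeq_of_isRightInversion {ω : List B} {t : W}
    (h : cs.IsRightInversion (cs.wordProd ω) t) : t ∈ cs.rightInvSeq ω := by
  classical
  rw [← cs.reflectionCocycle_eq_one_iff h.1, reflectionCocycle_wordProd] at h
  by_contra hmem
  rw [List.count_eq_zero_of_not_mem hmem] at h
  simp at h

/-! ### The exponent of a growth monomial -/

section Exponent

variable {I : Type*} (i : B → I)

open scoped Classical in
/-- The basis vector `single (i s) 1` for a reflection conjugate to the simple reflection `s`,
and `0` for an element that is not a reflection. The simple reflection is chosen arbitrarily; the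
choice does not matter if `i` is constant on conjugacy classes. -/
noncomputable def reflectionWeight (t : W) : I →₀ ℕ :=
  if h : cs.IsReflection t then Finsupp.single (i h.choose_spec.choose) 1 else 0

variable {i} (hi : ∀ s s' : B, IsConj (cs.simple s) (cs.simple s') → i s = i s')
include hi

theorem reflectionWeight_conj (u : W) (s : B) :
    cs.reflectionWeight i (u⁻¹ * cs.simple s * u) = Finsupp.single (i s) 1 := by
  have h : cs.IsReflection (u⁻¹ * cs.simple s * u) := ⟨u⁻¹, s, by simp⟩
  rw [reflectionWeight, dif_pos h]
  congr 1
  refine hi _ _ (isConj_iff.2 ⟨u * h.choose, ?_⟩)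
  have h' := h.choose_spec.choose_spec
  rw [mul_inv_rev, show u * h.choose * cs.simple h.choose_spec.choose * (h.choose⁻¹ * u⁻¹) =
    u * (h.choose * cs.simple h.choose_spec.choose * h.choose⁻¹) * u⁻¹ by group, ← h']
  group

theorem map_reflectionWeight_rightInvSeq (ω : List B) :
    (cs.rightInvSeq ω).map (cs.reflectionWeight i) =
      ω.map fun s => Finsupp.single (i s) 1 := by
  induction ω with
  | nil => rfl
  | cons s ω ih => simp [rightInvSeq, ih, cs.reflectionWeight_conj hi]

/-- The exponent can be read off any reduced word: the letters correspond to the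
right inversions of the element, which do not depend on the word. -/
theorem growthExponent_wordProd {ω : List B} (hω : cs.IsReduced ω) :
    cs.growthExponent i (cs.wordProd ω) = (ω.map fun s => Finsupp.single (i s) 1).sum := by
  have hr : cs.IsReduced (cs.reducedWord (cs.wordProd ω)) ∧
      cs.wordProd ω = cs.wordProd (cs.reducedWord (cs.wordProd ω)) :=
    (cs.exists_isReduced (cs.wordProd ω)).choose_spec
  rw [growthExponent, ← cs.map_reflectionWeight_rightInvSeq hi,
    ← cs.map_reflectionWeight_rightInvSeq hi]
  refine List.Perm.sum_eq (List.Perm.map _ ?_)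
  refine (List.perm_ext_iff_of_nodup hr.1.nodup_rightInvSeq hω.nodup_rightInvSeq).2 fun t => ?_
  constructor <;> intro h
  · have := cs.isRightInversion_of_mem_rightInvSeq hr.1 h
    rw [← hr.2] at this
    exact cs.mem_rightInvSeq_of_isRightInversion this
  · have := cs.isRightInversion_of_mem_rightInvSeq hω h
    rw [hr.2] at this
    exact cs.mem_rightInvSeq_of_isRightInversion this

theorem growthExponent_mul {u v : W} (h : cs.length (u * v) = cs.length u + cs.length v) :
    cs.growthExponent i (u * v) = cs.growthExponent i u + cs.growthExponent i v := by
  obtain ⟨ω, hω, rfl⟩ := cs.exists_isReduced u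
  obtain ⟨ω', hω', rfl⟩ := cs.exists_isReduced v
  have hr : cs.IsReduced (ω ++ ω') := by
    rw [IsReduced, wordProd_append, h, hω.eq, hω'.eq, List.length_append]
  rw [← wordProd_append, cs.growthExponent_wordProd hi hr, cs.growthExponent_wordProd hi hω,
    cs.growthExponent_wordProd hi hω', List.map_append, List.sum_append]

omit hi

theorem degree_growthExponent (w : W) : (cs.growthExponent i w).degree = cs.length w := by
  obtain ⟨h1, h2⟩ := (cs.exists_isReduced w).choose_spec
  have h3 : ∀ ω : List B, (ω.map fun s => Finsupp.single (i s) 1).sum.degree = ω.length := by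
    intro ω
    induction ω with
    | nil => simp
    | cons s ω ih => simp [ih, add_comm]
  rw [growthExponent, h3]
  conv_rhs => rw [h2]
  exact h1.symm

theorem growthExponent_one : cs.growthExponent i 1 = 0 := by
  rw [← Finsupp.degree_eq_zero_iff, degree_growthExponent, length_one]

end Exponent

theorem finite_length_le [Finite B] (n : ℕ) : {w : W | cs.length w ≤ n}.Finite := by
  refine ((List.finite_length_le B n).image cs.wordProd).subset fun w hw => ?_
  obtain ⟨ω, hω, rfl⟩ := cs.exists_isReduced w
  exact ⟨ω, by simpa [hω.eq] using hw, rfl⟩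

/-! ### Parabolic subgroups and descents -/

theorem simple_mem_parabolic {T : Set B} {s : B} (hs : s ∈ T) : cs.simple s ∈ cs.parabolic T :=
  Subgroup.subset_closure (Set.mem_image_of_mem _ hs)

theorem parabolic_mono {T U : Set B} (h : U ⊆ T) : cs.parabolic U ≤ cs.parabolic T :=
  Subgroup.closure_mono (Set.image_mono h)

theorem parabolic_univ : cs.parabolic Set.univ = ⊤ := by
  rw [parabolic, Set.image_univ, subgroup_closure_range_simple]

theorem exists_word_of_mem_parabolic {T : Set B} {v : W} (hv : v ∈ cs.parabolic T) :
    ∃ ω : List B, (∀ s ∈ ω, s ∈ T) ∧ cs.wordProd ω = v := by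
  induction hv using Subgroup.closure_induction with
  | mem x hx =>
    obtain ⟨s, hs, rfl⟩ := hx
    exact ⟨[s], by simpa using hs, by simp⟩
  | one => exact ⟨[], by simp, by simp⟩
  | mul x y _ _ hx hy =>
    obtain ⟨ω, h, rfl⟩ := hx
    obtain ⟨ω', h', rfl⟩ := hy
    refine ⟨ω ++ ω', fun s hs => ?_, cs.wordProd_append _ _⟩
    rcases List.mem_append.1 hs with hs | hs
    exacts [h s hs, h' s hs]
  | inv x _ hx =>
    obtain ⟨ω, h, rfl⟩ := hx
    exact ⟨ω.reverse, by simpa using h, by simp⟩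

theorem exists_rightDescent_of_word {T : Set B} (n : ℕ) (ω : List B) (hn : ω.length = n)
    (hT : ∀ s ∈ ω, s ∈ T) (h1 : cs.wordProd ω ≠ 1) :
    ∃ s ∈ T, cs.IsRightDescent (cs.wordProd ω) s := by
  induction n using Nat.strong_induction_on generalizing ω with
  | _ n ih =>
    rcases List.eq_nil_or_concat ω with rfl | ⟨ω', s, rfl⟩
    · simp at h1
    have hs : s ∈ T := hT s (by simp)
    by_cases hd : cs.IsRightDescent (cs.wordProd (ω'.concat s)) s
    · exact ⟨s, hs, hd⟩
    rw [isRightDescent_iff_not_isRightDescent_mul, wordProd_concat, not_not,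
      simple_mul_simple_cancel_right, ← isRightInversion_simple_iff_isRightDescent] at hd
    -- If the last letter is not a descent, then exchange shortens the word within `T`.
    obtain ⟨j, hj, he⟩ := List.mem_iff_getElem.1 (cs.mem_rightInvSeq_of_isRightInversion hd)
    have hprod : cs.wordProd (ω'.concat s) = cs.wordProd (ω'.eraseIdx j) := by
      rw [← wordProd_mul_getD_rightInvSeq, List.getD_eq_getElem _ 1 hj, he, wordProd_concat]
    rw [hprod] at h1 ⊢
    refine ih _ ?_ _ rfl (fun r hr => hT r ?_) h1
    · have := List.length_eraseIdx_le ω' j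
      simp only [List.length_concat] at hn
      omega
    · simp [List.mem_of_mem_eraseIdx hr]

theorem exists_rightDescent_of_mem_parabolic {T : Set B} {v : W} (hv : v ∈ cs.parabolic T)
    (h1 : v ≠ 1) : ∃ s ∈ T, cs.IsRightDescent v s := by
  obtain ⟨ω, hω, rfl⟩ := cs.exists_word_of_mem_parabolic hv
  exact cs.exists_rightDescent_of_word _ ω rfl hω h1

/-- Induction on the elements of a parabolic subgroup, along reduced expressions. -/
theorem parabolic_induction {T : Set B} {p : W → Prop} (one : p 1)
    (mul : ∀ v ∈ cs.parabolic T, ∀ s ∈ T, cs.length (v * cs.simple s) = cs.length v + 1 →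
      p v → p (v * cs.simple s)) {v : W} (hv : v ∈ cs.parabolic T) : p v := by
  induction hn : cs.length v using Nat.strong_induction_on generalizing v with
  | _ n ih =>
    by_cases h1 : v = 1
    · rwa [h1]
    obtain ⟨s, hs, hd⟩ := cs.exists_rightDescent_of_mem_parabolic hv h1
    have hm := mul_mem hv (cs.simple_mem_parabolic hs)
    have hl := cs.isRightDescent_iff.1 hd
    have := mul _ hm s hs (by simp [hl]) (ih _ (by omega) hm rfl)
    simpa using this

/-- Lengths add when an element is multiplied by an element of `W_T` and is shortest in its coset
modulo `W_T`. -/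
theorem length_mul_of_minimal {T : Set B} {u : W}
    (hu : ∀ x ∈ cs.parabolic T, cs.length u ≤ cs.length (u * x)) {v : W}
    (hv : v ∈ cs.parabolic T) : cs.length (u * v) = cs.length u + cs.length v := by
  refine cs.parabolic_induction (p := fun v => cs.length (u * v) = cs.length u + cs.length v)
    (by simp) (fun v hv s hs hl ih => ?_) hv
  rw [← mul_assoc]
  rcases cs.length_mul_simple (u * v) s with h | h
  · omega
  exfalso
  have hd : cs.IsRightInversion (u * v) (cs.simple s) :=
    ⟨cs.isReflection_simple s, by omega⟩
  rw [cs.isRightInversion_mul_iff (cs.isReflection_simple s)] at hd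
  -- The inversion `s` of `u v` comes from the inversion `v s v⁻¹ ∈ W_T` of `u`.
  by_cases hs' : cs.IsRightInversion v (cs.simple s)
  · have := hs'.2
    omega
  · have h2 : cs.IsRightInversion u (v * cs.simple s * v⁻¹) := by
      by_contra h3
      exact hs' (hd.2 h3)
    have := hu _ (mul_mem (mul_mem hv (cs.simple_mem_parabolic hs)) (inv_mem hv))
    exact absurd h2.2 (by omega)

theorem exists_minimal_mul (T : Set B) (w : W) : ∃ v ∈ cs.parabolic T,
    ∀ x ∈ cs.parabolic T, cs.length (w * v) ≤ cs.length (w * v * x) := by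
  let P : Set W := (fun v => w * v) '' (cs.parabolic T : Set W)
  have hP : P.Nonempty := ⟨w * 1, 1, one_mem _, rfl⟩
  obtain ⟨v, hv, hv'⟩ := Function.argminOn_mem cs.length P hP
  refine ⟨v, hv, fun x hx => ?_⟩
  change w * v = _ at hv'
  conv_lhs => rw [hv']
  exact Function.argminOn_le cs.length P ⟨v * x, mul_mem hv hx, by simp [mul_assoc]⟩

/-- Lengths add when an element without right descents in `T` is multiplied by an element
of `W_T`. -/
theorem length_mul_of_forall_not_isRightDescent {T : Set B} {u : W}
    (hu : ∀ s ∈ T, ¬ cs.IsRightDescent u s) {v : W} (hv : v ∈ cs.parabolic T) :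
    cs.length (u * v) = cs.length u + cs.length v := by
  obtain ⟨x, hx, hmin⟩ := cs.exists_minimal_mul T u
  suffices x = 1 by
    subst this
    rw [mul_one] at hmin
    exact cs.length_mul_of_minimal hmin hv
  by_contra h1
  obtain ⟨s, hs, hd⟩ := cs.exists_rightDescent_of_mem_parabolic (inv_mem hx) (by simpa using h1)
  refine hu s hs ?_
  have h2 := cs.length_mul_of_minimal hmin (inv_mem hx)
  have h3 := cs.length_mul_of_minimal hmin
    (mul_mem (inv_mem hx) (cs.simple_mem_parabolic hs))
  rw [mul_inv_cancel_right] at h2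
  rw [← mul_assoc, mul_inv_cancel_right] at h3
  have h4 : cs.length (x⁻¹ * cs.simple s) < cs.length x⁻¹ := hd
  rw [IsRightDescent]
  omega

theorem exists_mul_of_parabolic (T : Set B) (w : W) : ∃ u v, v ∈ cs.parabolic T ∧
    (∀ s ∈ T, ¬ cs.IsRightDescent u s) ∧ u * v = w := by
  obtain ⟨x, hx, hmin⟩ := cs.exists_minimal_mul T w
  refine ⟨w * x, x⁻¹, inv_mem hx, fun s hs hd => ?_, by simp⟩
  exact absurd hd (not_lt.2 (hmin _ (cs.simple_mem_parabolic hs)))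

theorem mul_parabolic_inj {T : Set B} {u u' v v' : W}
    (hu : ∀ s ∈ T, ¬ cs.IsRightDescent u s) (hu' : ∀ s ∈ T, ¬ cs.IsRightDescent u' s)
    (hv : v ∈ cs.parabolic T) (hv' : v' ∈ cs.parabolic T) (h : u * v = u' * v') :
    u = u' ∧ v = v' := by
  have hx : v * v'⁻¹ ∈ cs.parabolic T := mul_mem hv (inv_mem hv')
  have e1 : u * (v * v'⁻¹) = u' := by rw [← mul_assoc, h]; simp
  have e2 : u' * (v * v'⁻¹)⁻¹ = u := by rw [← e1]; exact mul_inv_cancel_right _ _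
  have l1 := cs.length_mul_of_forall_not_isRightDescent hu hx
  have l2 := cs.length_mul_of_forall_not_isRightDescent hu' (inv_mem hx)
  rw [e1] at l1
  rw [e2] at l2
  have h0 : v * v'⁻¹ = 1 := by
    rw [← cs.length_eq_zero_iff]
    omega
  rw [h0, mul_one] at e1
  exact ⟨e1, mul_inv_eq_one.1 h0⟩

/-- If all generators in `T` are right descents of `w`, then every element of `W_T` is a suffix of a
reduced expression for `w`. -/
theorem length_eq_add_of_forall_isRightDescent {T : Set B} {w : W}
    (hw : ∀ s ∈ T, cs.IsRightDescent w s) {x : W} (hx : x ∈ cs.parabolic T) :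
    cs.length w = cs.length (w * x⁻¹) + cs.length x := by
  refine cs.parabolic_induction
    (p := fun x => cs.length w = cs.length (w * x⁻¹) + cs.length x)
    (by simp) (fun x hx s hs hl ih => ?_) hx
  have hd : cs.IsRightInversion (w * x⁻¹ * x) (cs.simple s) := by
    simpa using hw s hs
  rw [cs.isRightInversion_mul_iff (cs.isReflection_simple s)] at hd
  have h2 : cs.IsRightInversion (w * x⁻¹) (x * cs.simple s * x⁻¹) := by
    by_contra h3
    have := (hd.2 h3).2
    omega
  have h3 := h2.2
  rw [show w * x⁻¹ * (x * cs.simple s * x⁻¹) = w * (x * cs.simple s)⁻¹ by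
    simp [mul_assoc]] at h3
  have h4 := cs.length_mul_le (w * (x * cs.simple s)⁻¹) (x * cs.simple s)
  rw [inv_mul_cancel_right] at h4
  omega

theorem finite_parabolic_of_forall_isRightDescent [Finite B] {T : Set B} {w : W}
    (hw : ∀ s ∈ T, cs.IsRightDescent w s) : (cs.parabolic T : Set W).Finite :=
  (cs.finite_length_le (cs.length w)).subset fun x hx => by
    have := cs.length_eq_add_of_forall_isRightDescent hw hx
    simp only [Set.mem_ofPred_eq]
    omega

end CoxeterSystem

/-! ### Quasi-inverses and rational series -/

namespace MvPowerSeries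

section QuasiInverse

variable {I R : Type*}

theorem degree_le_of_mem_antidiagonal_right [DecidableEq I] {n : I →₀ ℕ}
    {x : (I →₀ ℕ) × (I →₀ ℕ)} (hx : x ∈ Finset.HasAntidiagonal.antidiagonal n) :
    x.2.degree ≤ n.degree := by
  rw [← Finset.HasAntidiagonal.mem_antidiagonal.1 hx, map_add]
  exact Nat.le_add_left _ _

theorem degree_le_of_mem_antidiagonal_left [DecidableEq I] {n : I →₀ ℕ}
    {x : (I →₀ ℕ) × (I →₀ ℕ)} (hx : x ∈ Finset.HasAntidiagonal.antidiagonal n) :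
    x.1.degree ≤ n.degree := by
  rw [← Finset.HasAntidiagonal.mem_antidiagonal.1 hx, map_add]
  exact Nat.le_add_right _ _

theorem coeff_list_prod_eq_zero_of_degree_lt [Semiring R] {L : List (MvPowerSeries I R)}
    (hL : ∀ p ∈ L, constantCoeff p = 0) {n : I →₀ ℕ} (hn : n.degree < L.length) :
    coeff n L.prod = 0 := by
  classical
  induction L generalizing n with
  | nil => simp at hn
  | cons p L ih =>
    rw [List.prod_cons, coeff_mul]
    refine Finset.sum_eq_zero fun x hx => ?_
    by_cases h : x.1 = 0
    · rw [h, coeff_zero_eq_constantCoeff_apply, hL p List.mem_cons_self, zero_mul]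
    · have h1 : x.1.degree ≠ 0 := fun h' => h ((Finsupp.degree_eq_zero_iff _).1 h')
      have h2 : x.1.degree + x.2.degree = n.degree := by
        rw [← map_add, Finset.HasAntidiagonal.mem_antidiagonal.1 hx]
      rw [List.length_cons] at hn
      rw [ih (fun q hq => hL q (List.mem_cons_of_mem p hq)) (by omega), mul_zero]

theorem coeff_pow_eq_zero_of_degree_lt [Semiring R] {p : MvPowerSeries I R}
    (h0 : constantCoeff p = 0) {k : ℕ} {n : I →₀ ℕ} (hn : n.degree < k) : coeff n (p ^ k) = 0 := by
  rw [← List.prod_replicate]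
  exact coeff_list_prod_eq_zero_of_degree_lt
    (fun q hq => by rwa [List.eq_of_mem_replicate hq]) (by simpa using hn)

theorem coeff_formalSum [Semiring R] {ι : Type*} (f : ι → MvPowerSeries I R) (n : I →₀ ℕ) :
    coeff n (formalSum f) = ∑ᶠ j, coeff n (f j) := rfl

theorem coeff_quasiInverse [Semiring R] {p : MvPowerSeries I R} (h0 : constantCoeff p = 0)
    {n : I →₀ ℕ} {N : ℕ} (hN : n.degree ≤ N) :
    coeff n p.quasiInverse = ∑ k ∈ Finset.range N, coeff n (p ^ (k + 1)) := by
  rw [quasiInverse, coeff_formalSum]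
  refine finsum_eq_sum_of_support_subset _ fun k hk => ?_
  by_contra h
  rw [Finset.coe_range, Set.mem_Iio] at h
  exact hk (coeff_pow_eq_zero_of_degree_lt h0 (by omega))

theorem constantCoeff_quasiInverse [Semiring R] {p : MvPowerSeries I R}
    (h0 : constantCoeff p = 0) : constantCoeff p.quasiInverse = 0 := by
  rw [← coeff_zero_eq_constantCoeff_apply, coeff_quasiInverse h0 (N := 0) (by simp)]
  simp

theorem coeff_sum_pow_eq_coeff_quasiInverse_add [Semiring R] {p : MvPowerSeries I R}
    (h0 : constantCoeff p = 0) (n : I →₀ ℕ) :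
    ∑ k ∈ Finset.range n.degree, coeff n (p ^ (k + 2)) + coeff n p = coeff n p.quasiInverse := by
  rw [coeff_quasiInverse h0 (Nat.le_succ n.degree), Finset.sum_range_succ']
  simp

theorem mul_quasiInverse_add [Semiring R] {p : MvPowerSeries I R} (h0 : constantCoeff p = 0) :
    p * p.quasiInverse + p = p.quasiInverse := by
  classical
  ext n
  rw [map_add, ← coeff_sum_pow_eq_coeff_quasiInverse_add h0, coeff_mul]
  congr 1
  trans ∑ x ∈ Finset.HasAntidiagonal.antidiagonal n, ∑ k ∈ Finset.range n.degree,
      coeff x.1 p * coeff x.2 (p ^ (k + 1))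
  · refine Finset.sum_congr rfl fun x hx => ?_
    rw [coeff_quasiInverse h0 (degree_le_of_mem_antidiagonal_right hx), Finset.mul_sum]
  rw [Finset.sum_comm]
  refine Finset.sum_congr rfl fun k _ => ?_
  rw [pow_succ' p (k + 1), coeff_mul]

theorem quasiInverse_mul_add [Semiring R] {p : MvPowerSeries I R} (h0 : constantCoeff p = 0) :
    p.quasiInverse * p + p = p.quasiInverse := by
  classical
  ext n
  rw [map_add, ← coeff_sum_pow_eq_coeff_quasiInverse_add h0, coeff_mul]
  congr 1
  trans ∑ x ∈ Finset.HasAntidiagonal.antidiagonal n, ∑ k ∈ Finset.range n.degree,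
      coeff x.1 (p ^ (k + 1)) * coeff x.2 p
  · refine Finset.sum_congr rfl fun x hx => ?_
    rw [coeff_quasiInverse h0 (degree_le_of_mem_antidiagonal_left hx), Finset.sum_mul]
  rw [Finset.sum_comm]
  refine Finset.sum_congr rfl fun k _ => ?_
  rw [pow_succ p (k + 1), coeff_mul]

variable [Ring R]

/-- The inverse `1 + (1 - p)⁺` of a power series `p` with constant term `1`. -/
noncomputable def geomInverse (p : MvPowerSeries I R) : MvPowerSeries I R :=
  1 + (1 - p).quasiInverse

variable {p : MvPowerSeries I R}

theorem constantCoeff_one_sub (h1 : constantCoeff p = 1) : constantCoeff (1 - p) = 0 := by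
  simp [h1]

theorem geomInverse_mul (h1 : constantCoeff p = 1) : p.geomInverse * p = 1 := by
  have h := quasiInverse_mul_add (constantCoeff_one_sub h1)
  have h' : p.geomInverse * p =
      1 + (1 - p).quasiInverse - ((1 - p).quasiInverse * (1 - p) + (1 - p)) := by
    rw [geomInverse]; noncomm_ring
  rw [h', h, add_sub_cancel_right]

theorem mul_geomInverse (h1 : constantCoeff p = 1) : p * p.geomInverse = 1 := by
  have h := mul_quasiInverse_add (constantCoeff_one_sub h1)
  have h' : p * p.geomInverse =
      1 + (1 - p).quasiInverse - ((1 - p) * (1 - p).quasiInverse + (1 - p)) := by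
    rw [geomInverse]; noncomm_ring
  rw [h', h, add_sub_cancel_right]

theorem constantCoeff_geomInverse (h1 : constantCoeff p = 1) :
    constantCoeff p.geomInverse = 1 := by
  simp [geomInverse, constantCoeff_quasiInverse (constantCoeff_one_sub h1)]

theorem geomInverse_geomInverse (h1 : constantCoeff p = 1) :
    p.geomInverse.geomInverse = p :=
  (left_inv_eq_right_inv (mul_geomInverse h1)
    (mul_geomInverse (constantCoeff_geomInverse h1))).symm

namespace IsRational

theorem monomial (n : I →₀ ℕ) (a : R) : IsRational (MvPowerSeries.monomial n a) := by
  classical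
  refine polynomial _ ((Set.finite_singleton n).subset fun m hm => ?_)
  by_contra h
  exact hm (coeff_monomial_ne h a)

theorem zero : IsRational (0 : MvPowerSeries I R) := by
  simpa using monomial (0 : I →₀ ℕ) (0 : R)

theorem one : IsRational (1 : MvPowerSeries I R) := monomial 0 1

theorem neg {p : MvPowerSeries I R} (hp : IsRational p) : IsRational (-p) := by
  have h : IsRational (-1 : MvPowerSeries I R) := by
    have h := monomial (0 : I →₀ ℕ) (-1 : R)
    rwa [map_neg] at h
  simpa using mul _ _ h hp

theorem neg_one_pow_smul {p : MvPowerSeries I R} (hp : IsRational p) (k : ℕ) :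
    IsRational ((-1 : ℤ) ^ k • p) := by
  rcases neg_one_pow_eq_or ℤ k with h | h <;> rw [h]
  · simpa using hp
  · simpa using hp.neg

theorem sum {ι : Type*} {s : Finset ι} {f : ι → MvPowerSeries I R}
    (h : ∀ j ∈ s, IsRational (f j)) : IsRational (∑ j ∈ s, f j) := by
  classical
  induction s using Finset.induction_on with
  | empty => simpa using zero
  | insert a s ha ih =>
    rw [Finset.sum_insert ha]
    exact add _ _ (h a (Finset.mem_insert_self a s))
      (ih fun j hj => h j (Finset.mem_insert_of_mem hj))

theorem geomInverse {p : MvPowerSeries I R} (hp : IsRational p) (h1 : constantCoeff p = 1) :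
    IsRational p.geomInverse := by
  refine add _ _ one (quasiInverse _ (constantCoeff_one_sub h1) ?_)
  rw [sub_eq_add_neg]
  exact add _ _ one hp.neg

end IsRational

end QuasiInverse

end MvPowerSeries

/-! ### Rationality of the growth series -/

namespace CoxeterSystem

variable {B W I R : Type*} [Group W] {M : CoxeterMatrix B} (cs : CoxeterSystem M W)

section Growth

variable [Finite B] [Ring R] (i : B → I) (ρ : W →* R)

theorem finite_growthExponent_eq (n : I →₀ ℕ) : {w : W | cs.growthExponent i w = n}.Finite :=
  (cs.finite_length_le n.degree).subset fun w hw => by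
    rw [Set.mem_ofPred_eq] at hw ⊢
    rw [← cs.degree_growthExponent (i := i), hw]

/-- The finite set of all elements of `X` with growth exponent `n`. -/
noncomputable def growthFiber (X : Set W) (n : I →₀ ℕ) : Finset W :=
  ((cs.finite_growthExponent_eq i n).inter_of_right X).toFinset

/-- The growth series `∑_{w ∈ X} ρ(w) t^w` of a subset `X` of `W`, twisted by a representation
`ρ` of `W` in a ring. -/
noncomputable def twistedGrowthSeries (X : Set W) : MvPowerSeries I R :=
  fun n => ∑ w ∈ cs.growthFiber i X n, ρ w

variable {cs i} in
theorem mem_growthFiber {X : Set W} {n : I →₀ ℕ} {w : W} :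
    w ∈ cs.growthFiber i X n ↔ w ∈ X ∧ cs.growthExponent i w = n := by
  simp [growthFiber]

theorem coeff_twistedGrowthSeries (X : Set W) (n : I →₀ ℕ) :
    MvPowerSeries.coeff n (cs.twistedGrowthSeries i ρ X) = ∑ w ∈ cs.growthFiber i X n, ρ w := rfl

theorem formalSum_monomial_eq :
    MvPowerSeries.formalSum (fun w : W =>
      MvPowerSeries.monomial (cs.growthExponent i w) (ρ w)) =
      cs.twistedGrowthSeries i ρ Set.univ := by
  classical
  ext n
  rw [MvPowerSeries.coeff_formalSum, coeff_twistedGrowthSeries,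
    finsum_eq_sum_of_support_subset (s := cs.growthFiber i Set.univ n)]
  · refine Finset.sum_congr rfl fun w hw => ?_
    rw [← (mem_growthFiber.1 hw).2, MvPowerSeries.coeff_monomial_same]
  · intro w hw
    rw [Finset.mem_coe, mem_growthFiber]
    refine ⟨trivial, ?_⟩
    by_contra h
    exact hw (MvPowerSeries.coeff_monomial_ne (Ne.symm h) _)

theorem constantCoeff_twistedGrowthSeries {X : Set W} (hX : (1 : W) ∈ X) :
    MvPowerSeries.constantCoeff (cs.twistedGrowthSeries i ρ X) = 1 := by
  rw [← MvPowerSeries.coeff_zero_eq_constantCoeff_apply, coeff_twistedGrowthSeries]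
  have h : cs.growthFiber i X 0 = {1} := by
    ext w
    rw [mem_growthFiber, Finset.mem_singleton, ← Finsupp.degree_eq_zero_iff,
      degree_growthExponent, length_eq_zero_iff]
    exact ⟨And.right, fun h => ⟨h ▸ hX, h⟩⟩
  rw [h, Finset.sum_singleton, map_one]

theorem isRational_twistedGrowthSeries_of_finite {X : Set W} (hX : X.Finite) :
    (cs.twistedGrowthSeries i ρ X).IsRational := by
  refine .polynomial _ ((hX.image (cs.growthExponent i)).subset fun n hn => ?_)
  rw [Set.mem_ofPred_eq, coeff_twistedGrowthSeries] at hn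
  obtain ⟨w, hw, -⟩ := Finset.exists_ne_zero_of_sum_ne_zero hn
  rw [mem_growthFiber] at hw
  exact ⟨w, hw.1, hw.2⟩

/-- The growth series is multiplicative for unique factorizations along which exponents add. -/
theorem twistedGrowthSeries_mul {X Y Z : Set W}
    (hbij : Set.BijOn (fun p : W × W => p.1 * p.2) (X ×ˢ Y) Z)
    (hexp : ∀ u ∈ X, ∀ v ∈ Y,
      cs.growthExponent i (u * v) = cs.growthExponent i u + cs.growthExponent i v) :
    cs.twistedGrowthSeries i ρ X * cs.twistedGrowthSeries i ρ Y =
      cs.twistedGrowthSeries i ρ Z := by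
  classical
  ext n
  simp only [MvPowerSeries.coeff_mul, coeff_twistedGrowthSeries, Finset.sum_mul_sum,
    ← Finset.sum_product']
  rw [Finset.sum_sigma']
  refine Finset.sum_bij (fun x _ => x.2.1 * x.2.2) ?_ ?_ ?_ ?_
  · rintro ⟨⟨a, b⟩, u, v⟩ h
    simp only [Finset.mem_sigma, Finset.mem_product,
      mem_growthFiber] at h ⊢
    obtain ⟨h1, ⟨hu, rfl⟩, hv, rfl⟩ := h
    rw [← Finset.HasAntidiagonal.mem_antidiagonal.1 h1]
    exact ⟨hbij.mapsTo (Set.mk_mem_prod hu hv), hexp u hu v hv⟩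
  · rintro ⟨⟨a, b⟩, u, v⟩ h ⟨⟨a', b'⟩, u', v'⟩ h' he
    simp only [Finset.mem_sigma, Finset.mem_product,
      mem_growthFiber] at h h' he
    obtain ⟨-, ⟨hu, rfl⟩, hv, rfl⟩ := h
    obtain ⟨-, ⟨hu', rfl⟩, hv', rfl⟩ := h'
    have := hbij.injOn (Set.mk_mem_prod hu hv) (Set.mk_mem_prod hu' hv') he
    obtain ⟨rfl, rfl⟩ := Prod.mk.inj this
    rfl
  · intro w hw
    rw [mem_growthFiber] at hw
    obtain ⟨hw, rfl⟩ := hw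
    obtain ⟨⟨u, v⟩, ⟨hu, hv⟩, rfl⟩ := hbij.surjOn hw
    refine ⟨⟨(cs.growthExponent i u, cs.growthExponent i v), u, v⟩, ?_, rfl⟩
    simp only [Finset.mem_sigma, Finset.mem_product, mem_growthFiber]
    exact ⟨Finset.HasAntidiagonal.mem_antidiagonal.2 (hexp u hu v hv).symm,
      ⟨hu, trivial⟩, hv, trivial⟩
  · intro x _
    exact (map_mul ρ _ _).symm

/-- The elements of `W_T` that are shortest in their coset modulo `W_U`. -/
def minimalCosetReps (T U : Set B) : Set W :=
  {w | w ∈ cs.parabolic T ∧ ∀ s ∈ U, ¬ cs.IsRightDescent w s}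

omit [Finite B] in
theorem bijOn_minimalCosetReps_mul {T U : Set B} (hU : U ⊆ T) :
    Set.BijOn (fun p : W × W => p.1 * p.2)
      (cs.minimalCosetReps T U ×ˢ (cs.parabolic U : Set W)) (cs.parabolic T) := by
  refine ⟨?_, ?_, ?_⟩
  · rintro ⟨u, v⟩ ⟨hu, hv⟩
    exact mul_mem hu.1 (cs.parabolic_mono hU hv)
  · rintro ⟨u, v⟩ ⟨hu, hv⟩ ⟨u', v'⟩ ⟨hu', hv'⟩ h
    exact Prod.ext_iff.2 (cs.mul_parabolic_inj hu.2 hu'.2 hv hv' h)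
  · intro w hw
    obtain ⟨u, v, hv, hu, rfl⟩ := cs.exists_mul_of_parabolic U w
    refine ⟨(u, v), ⟨⟨?_, hu⟩, hv⟩, rfl⟩
    exact (Subgroup.mul_mem_cancel_right _ (cs.parabolic_mono hU hv)).1 hw

/-- If `W_T` is infinite, then no element of `W_T` has all of `T` as right descents, and the
growth series of the sets of minimal coset representatives have vanishing alternating sum. -/
theorem alternating_sum_minimalCosetReps {T : Finset B}
    (hT : ¬ (cs.parabolic (T : Set B) : Set W).Finite) :
    ∑ U ∈ T.powerset,
      (-1 : ℤ) ^ U.card • cs.twistedGrowthSeries i ρ (cs.minimalCosetReps T U) = 0 := by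
  classical
  ext n
  let N (w : W) : Finset B := T.filter fun s => ¬ cs.IsRightDescent w s
  have hcoeff : ∀ U ∈ T.powerset,
      MvPowerSeries.coeff n ((-1 : ℤ) ^ U.card •
        cs.twistedGrowthSeries i ρ (cs.minimalCosetReps T U)) =
      ∑ w ∈ cs.growthFiber i (cs.parabolic (T : Set B)) n,
        if U ∈ (N w).powerset then (-1 : ℤ) ^ U.card • ρ w else 0 := by
    intro U hU
    rw [Finset.mem_powerset] at hU
    rw [map_zsmul, coeff_twistedGrowthSeries, ← Finset.sum_filter, Finset.smul_sum]
    refine Finset.sum_congr ?_ fun _ _ => rfl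
    ext w
    have hUN : U ∈ (N w).powerset ↔ ∀ s ∈ U, ¬ cs.IsRightDescent w s := by
      rw [Finset.mem_powerset]
      exact ⟨fun h s hs => (Finset.mem_filter.1 (h hs)).2,
        fun h s hs => Finset.mem_filter.2 ⟨hU hs, h s hs⟩⟩
    rw [Finset.mem_filter, mem_growthFiber, mem_growthFiber, hUN]
    simp only [minimalCosetReps, Set.mem_ofPred_eq, SetLike.mem_coe]
    tauto
  rw [map_sum, Finset.sum_congr rfl hcoeff, Finset.sum_comm, map_zero]
  refine Finset.sum_eq_zero fun w _ => ?_
  have hN : (N w).Nonempty := by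
    by_contra h
    rw [Finset.not_nonempty_iff_eq_empty, Finset.filter_eq_empty_iff] at h
    exact hT (cs.finite_parabolic_of_forall_isRightDescent (w := w)
      fun s hs => not_not.1 (h (Finset.mem_coe.1 hs)))
  rw [← Finset.sum_filter, Finset.filter_mem_eq_inter, Finset.inter_eq_right.2
    (Finset.powerset_mono.2 (Finset.filter_subset _ _)), ← Finset.sum_smul,
    Finset.sum_powerset_neg_one_pow_card_of_nonempty hN, zero_smul]

variable {i} (hi : ∀ s s' : B, IsConj (cs.simple s) (cs.simple s') → i s = i s')
include hi

theorem twistedGrowthSeries_minimalCosetReps {T U : Set B} (hU : U ⊆ T) :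
    cs.twistedGrowthSeries i ρ (cs.minimalCosetReps T U) =
      cs.twistedGrowthSeries i ρ (cs.parabolic T) *
        (cs.twistedGrowthSeries i ρ (cs.parabolic U)).geomInverse := by
  rw [← cs.twistedGrowthSeries_mul i ρ (cs.bijOn_minimalCosetReps_mul hU), mul_assoc,
    MvPowerSeries.mul_geomInverse (cs.constantCoeff_twistedGrowthSeries i ρ (one_mem _)), mul_one]
  exact fun u hu v hv => cs.growthExponent_mul hi
    (cs.length_mul_of_forall_not_isRightDescent hu.2 hv)

/-- If `W_T` is infinite, the inverses of the growth series of the parabolic subgroups contained in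
`W_T` have vanishing alternating sum. -/
theorem alternating_sum_geomInverse {T : Finset B}
    (hT : ¬ (cs.parabolic (T : Set B) : Set W).Finite) :
    ∑ U ∈ T.powerset, (-1 : ℤ) ^ U.card •
      (cs.twistedGrowthSeries i ρ (cs.parabolic (U : Set B))).geomInverse = 0 := by
  have h1 := MvPowerSeries.geomInverse_mul
    (cs.constantCoeff_twistedGrowthSeries i ρ (one_mem (cs.parabolic (T : Set B))))
  have h := cs.alternating_sum_minimalCosetReps i ρ hT
  have h2 : ∀ U ∈ T.powerset, (-1 : ℤ) ^ U.card •
      cs.twistedGrowthSeries i ρ (cs.minimalCosetReps T U) =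
      cs.twistedGrowthSeries i ρ (cs.parabolic (T : Set B)) * ((-1 : ℤ) ^ U.card •
        (cs.twistedGrowthSeries i ρ (cs.parabolic (U : Set B))).geomInverse) := by
    intro U hU
    rw [cs.twistedGrowthSeries_minimalCosetReps ρ hi
      (Finset.coe_subset.2 (Finset.mem_powerset.1 hU)), mul_smul_comm]
  rw [Finset.sum_congr rfl h2, ← Finset.mul_sum] at h
  rw [← one_mul (Finset.sum _ _), ← h1, mul_assoc, h, mul_zero]

theorem isRational_geomInverse_parabolic (T : Finset B) :
    (cs.twistedGrowthSeries i ρ (cs.parabolic (T : Set B))).geomInverse.IsRational := by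
  classical
  induction T using Finset.strongInduction with
  | _ T ih =>
    by_cases hT : (cs.parabolic (T : Set B) : Set W).Finite
    · exact (cs.isRational_twistedGrowthSeries_of_finite i ρ hT).geomInverse
        (cs.constantCoeff_twistedGrowthSeries i ρ (one_mem _))
    -- The alternating sum expresses the inverse for `T` by those for the proper subsets of `T`.
    have h := cs.alternating_sum_geomInverse ρ hi hT
    have hr : MvPowerSeries.IsRational (∑ U ∈ T.ssubsets, (-1 : ℤ) ^ U.card •
        (cs.twistedGrowthSeries i ρ (cs.parabolic (U : Set B))).geomInverse) :=
      .sum fun U hU => (ih U (Finset.mem_ssubsets.1 hU)).neg_one_pow_smul _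
    rw [← Finset.insert_erase (Finset.mem_powerset_self T),
      Finset.sum_insert (Finset.notMem_erase _ _), ← Finset.ssubsets] at h
    have h' := hr.neg.neg_one_pow_smul T.card
    rw [← eq_neg_of_add_eq_zero_left h, smul_smul, ← mul_pow] at h'
    simpa using h'

theorem isRational_twistedGrowthSeries_univ :
    (cs.twistedGrowthSeries i ρ Set.univ).IsRational := by
  have := Fintype.ofFinite B
  have h1 : MvPowerSeries.constantCoeff (cs.twistedGrowthSeries i ρ Set.univ) = 1 :=
    cs.constantCoeff_twistedGrowthSeries i ρ trivial
  have h := cs.isRational_geomInverse_parabolic ρ hi Finset.univ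
  rw [Finset.coe_univ, parabolic_univ, Subgroup.coe_top] at h
  rw [← MvPowerSeries.geomInverse_geomInverse h1]
  exact h.geomInverse (MvPowerSeries.constantCoeff_geomInverse h1)

end Growth

end CoxeterSystem

/-! ### Substitution into noncommutative power series -/

namespace NCPowerSeries

variable {A I R : Type*} [Semiring R] [Algebra ℚ R]

theorem charSeries_singleton_apply [DecidableEq A] (β α : List A) :
    coeff α (charSeries ({β} : Set (List A))) = if α = β then 1 else 0 := by
  by_cases h : α = β
  · rw [if_pos h]
    exact if_pos h
  · rw [if_neg h]
    exact if_neg h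

theorem one_eq_charSeries : (1 : NCPowerSeries A) = charSeries ({[]} : Set (List A)) := by
  classical
  ext α
  rw [charSeries_singleton_apply]
  cases α <;> simp

theorem subst_charSeries_singleton (f : A → MvPowerSeries I R) (β : List A) :
    subst f (charSeries ({β} : Set (List A))) = (β.map f).prod := by
  classical
  ext n
  rw [subst, MvPowerSeries.coeff_formalSum, finsum_eq_single _ β]
  · simp [charSeries_singleton_apply]
  · intro α hα
    simp [charSeries_singleton_apply, hα]

theorem subst_letter (f : A → MvPowerSeries I R) (a : A) : subst f (letter a) = f a := by
  rw [letter, subst_charSeries_singleton, List.map_singleton, List.prod_singleton]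

theorem coeff_rat_smul (c : ℚ) (p : MvPowerSeries I R) (n : I →₀ ℕ) :
    MvPowerSeries.coeff n (c • p) = c • MvPowerSeries.coeff n p := rfl

variable [Finite A]

/-- The finite set of all words of length at most `N` in a finite alphabet. -/
noncomputable def words (A : Type*) [Finite A] (N : ℕ) : Finset (List A) :=
  (List.finite_length_le A N).toFinset

theorem mem_words {N : ℕ} {α : List A} : α ∈ words A N ↔ α.length ≤ N := by
  simp [words]

variable {f : A → MvPowerSeries I R} (hf : ∀ a, MvPowerSeries.constantCoeff (f a) = 0)
include hf

omit [Algebra ℚ R] [Finite A] in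
theorem coeff_map_prod_eq_zero {n : I →₀ ℕ} {α : List A} (h : n.degree < α.length) :
    MvPowerSeries.coeff n (α.map f).prod = 0 :=
  MvPowerSeries.coeff_list_prod_eq_zero_of_degree_lt
    (by simpa using fun a _ => hf a) (by simpa using h)

/-- If the letters are replaced by series without constant term, only the words of length at most
`n` contribute to the coefficients of degree `n`. -/
theorem coeff_subst (l : NCPowerSeries A) {n : I →₀ ℕ} {N : ℕ} (hN : n.degree ≤ N) :
    MvPowerSeries.coeff n (subst f l) =
      ∑ α ∈ words A N, coeff α l • MvPowerSeries.coeff n (α.map f).prod := by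
  rw [subst, MvPowerSeries.coeff_formalSum]
  refine finsum_eq_sum_of_support_subset _ fun α hα => ?_
  rw [Finset.mem_coe, mem_words]
  by_contra h
  refine hα ?_
  dsimp only
  rw [coeff_rat_smul, coeff_map_prod_eq_zero hf (by omega), smul_zero]

theorem subst_add (l m : NCPowerSeries A) : subst f (l + m) = subst f l + subst f m := by
  ext n
  rw [map_add]
  simp only [coeff_subst hf _ le_rfl, coeff_add, add_smul, Finset.sum_add_distrib]

theorem subst_smul (c : ℚ) (l : NCPowerSeries A) : subst f (c • l) = c • subst f l := by
  ext n
  rw [coeff_rat_smul]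
  simp only [coeff_subst hf _ le_rfl, coeff_smul, mul_smul, Finset.smul_sum]

theorem subst_mul (l m : NCPowerSeries A) : subst f (l * m) = subst f l * subst f m := by
  classical
  ext n
  set N := n.degree with hN
  have hleft : MvPowerSeries.coeff n (subst f (l * m)) =
      ∑ α ∈ words A N, ∑ k ∈ Finset.range (α.length + 1),
        (coeff (α.take k) l * coeff (α.drop k) m) • MvPowerSeries.coeff n (α.map f).prod := by
    rw [coeff_subst hf _ le_rfl]
    simp only [coeff_mul, Finset.sum_smul]
    rfl
  have hright : MvPowerSeries.coeff n (subst f l * subst f m) =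
      ∑ p ∈ words A N ×ˢ words A N,
        (coeff p.1 l * coeff p.2 m) • MvPowerSeries.coeff n ((p.1 ++ p.2).map f).prod := by
    rw [MvPowerSeries.coeff_mul]
    trans ∑ x ∈ Finset.HasAntidiagonal.antidiagonal n, ∑ p ∈ words A N ×ˢ words A N,
        (coeff p.1 l * coeff p.2 m) •
          (MvPowerSeries.coeff x.1 (p.1.map f).prod * MvPowerSeries.coeff x.2 (p.2.map f).prod)
    · refine Finset.sum_congr rfl fun x hx => ?_
      rw [coeff_subst hf _ (MvPowerSeries.degree_le_of_mem_antidiagonal_left hx),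
        coeff_subst hf _ (MvPowerSeries.degree_le_of_mem_antidiagonal_right hx),
        Finset.sum_mul_sum, ← Finset.sum_product']
      exact Finset.sum_congr rfl fun p _ => smul_mul_smul_comm _ _ _ _
    · rw [Finset.sum_comm]
      refine Finset.sum_congr rfl fun p _ => ?_
      rw [← Finset.smul_sum, List.map_append, List.prod_append, MvPowerSeries.coeff_mul]
  -- Factorizations `α = β γ` are matched with the cutting positions in `α`; the pairs `(β, γ)` for
  -- which `β γ` is longer than the degree do not contribute.
  rw [hleft, hright, Finset.sum_sigma',
    ← Finset.sum_filter_add_sum_filter_not _ (fun p : List A × List A =>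
      p.1.length + p.2.length ≤ N), Finset.sum_eq_zero (s := Finset.filter (fun p => ¬ _) _),
    add_zero]
  · refine Finset.sum_bij' (fun x _ => (x.1.take x.2, x.1.drop x.2))
      (fun p _ => ⟨p.1 ++ p.2, p.1.length⟩) ?_ ?_ ?_ ?_ ?_
    · rintro ⟨α, k⟩ h
      simp only [Finset.mem_sigma, Finset.mem_range, mem_words] at h
      simp only [Finset.mem_filter, Finset.mem_product, mem_words, List.length_take,
        List.length_drop]
      omega
    · rintro ⟨β, γ⟩ h
      simp only [Finset.mem_filter, Finset.mem_product, mem_words] at h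
      simp only [Finset.mem_sigma, Finset.mem_range, mem_words, List.length_append]
      omega
    · rintro ⟨α, k⟩ h
      simp only [Finset.mem_sigma, Finset.mem_range, mem_words] at h
      simp only [List.take_append_drop, List.length_take, Sigma.mk.injEq, heq_eq_eq, true_and]
      omega
    · rintro ⟨β, γ⟩ _
      simp
    · rintro ⟨α, k⟩ _
      simp
  · intro p h
    simp only [Finset.mem_filter, Finset.mem_product, mem_words] at h
    obtain ⟨_, h⟩ := h
    rw [coeff_map_prod_eq_zero hf (by rw [List.length_append]; omega), smul_zero]

/-- Substitution of series without constant term for the letters of a finite alphabet, as an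
algebra homomorphism. -/
noncomputable def substAlgHom : NCPowerSeries A →ₐ[ℚ] MvPowerSeries I R :=
  AlgHom.ofLinearMap
    { toFun := subst f
      map_add' := subst_add hf
      map_smul' := subst_smul hf }
    (by
      change subst f 1 = 1
      rw [one_eq_charSeries, subst_charSeries_singleton, List.map_nil, List.prod_nil])
    (subst_mul hf)

end NCPowerSeries

/-! ### The greedy normal form -/

namespace CoxeterSystem

variable {B W I : Type*} [Group W] {M : CoxeterMatrix B} (cs : CoxeterSystem M W)

instance [Finite B] : Finite cs.ProperNerve :=
  inferInstanceAs (Finite {σ : Set B // σ.Nonempty ∧ (cs.parabolic σ : Set W).Finite})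

theorem longest_mem (σ : cs.ProperNerve) : cs.longest σ ∈ cs.parabolic σ.1 :=
  (cs.exists_longest σ).choose_spec.1

theorem length_longest_pos (σ : cs.ProperNerve) : 0 < cs.length (cs.longest σ) := by
  obtain ⟨s, hs⟩ := σ.2.1
  have h := (cs.exists_longest σ).choose_spec.2 _ (cs.simple_mem_parabolic hs)
  rw [length_simple] at h
  exact h

theorem nerveProd_cons (σ : cs.ProperNerve) (α : List cs.ProperNerve) :
    cs.nerveProd (σ :: α) = cs.longest σ * cs.nerveProd α := by
  simp [nerveProd]

/-- The longest element of `W_σ` is a prefix of a reduced expression of every element with left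
descent set `σ`. -/
theorem length_longest_mul {σ : cs.ProperNerve} {v : W}
    (h : σ.1 = cs.leftDescentSet (cs.longest σ * v)) :
    cs.length (cs.longest σ * v) = cs.length (cs.longest σ) + cs.length v := by
  have hd : ∀ s ∈ σ.1, cs.IsRightDescent (cs.longest σ * v)⁻¹ s := by
    intro s hs
    rw [h] at hs
    exact cs.isRightDescent_inv_iff.2 hs
  have h1 := cs.length_eq_add_of_forall_isRightDescent hd (inv_mem (cs.longest_mem σ))
  rw [inv_inv, mul_inv_rev, inv_mul_cancel_right, ← mul_inv_rev, length_inv, length_inv,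
    length_inv] at h1
  omega

theorem nil_mem_greedyNormalForm : ([] : List cs.ProperNerve) ∈ cs.greedyNormalForm := by
  intro σ β h
  simp at h

theorem cons_mem_greedyNormalForm {σ : cs.ProperNerve} {α : List cs.ProperNerve} :
    σ :: α ∈ cs.greedyNormalForm ↔
      σ.1 = cs.leftDescentSet (cs.longest σ * cs.nerveProd α) ∧ α ∈ cs.greedyNormalForm := by
  rw [← nerveProd_cons]
  constructor
  · exact fun h => ⟨h σ α List.suffix_rfl,
      fun τ β hs => h τ β (hs.trans (List.suffix_cons σ α))⟩
  · rintro ⟨h1, h2⟩ τ β hs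
    rcases List.suffix_cons_iff.1 hs with h | h
    · obtain ⟨rfl, rfl⟩ := List.cons.inj h
      exact h1
    · exact h2 τ β h

theorem leftDescentSet_one : cs.leftDescentSet 1 = ∅ :=
  Set.eq_empty_of_forall_notMem fun s hs => cs.not_isLeftDescent_one s hs

theorem injOn_nerveProd : Set.InjOn cs.nerveProd cs.greedyNormalForm := by
  intro α hα
  induction α with
  | nil =>
    rintro (_ | ⟨τ, β⟩) hβ h
    · rfl
    · have h1 := (cs.cons_mem_greedyNormalForm.1 hβ).1
      rw [← nerveProd_cons, ← h, nerveProd, List.map_nil, List.prod_nil,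
        leftDescentSet_one] at h1
      exact absurd h1 τ.2.1.ne_empty
  | cons σ α ih =>
    obtain ⟨h1, h2⟩ := cs.cons_mem_greedyNormalForm.1 hα
    rintro (_ | ⟨τ, β⟩) hβ h
    · rw [← nerveProd_cons, h, nerveProd, List.map_nil, List.prod_nil,
        leftDescentSet_one] at h1
      exact absurd h1 σ.2.1.ne_empty
    · obtain ⟨h3, h4⟩ := cs.cons_mem_greedyNormalForm.1 hβ
      rw [← nerveProd_cons] at h1 h3
      obtain rfl : σ = τ := Subtype.ext (by rw [h1, h3, h])
      rw [nerveProd_cons, nerveProd_cons, mul_right_inj] at h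
      rw [ih h2 h4 h]

theorem surjOn_nerveProd [Finite B] : Set.SurjOn cs.nerveProd cs.greedyNormalForm Set.univ := by
  intro w _
  induction hn : cs.length w using Nat.strong_induction_on generalizing w with
  | _ n ih =>
    by_cases h1 : w = 1
    · exact ⟨[], cs.nil_mem_greedyNormalForm, h1.symm⟩
    have hd : ∀ s ∈ cs.leftDescentSet w, cs.IsRightDescent w⁻¹ s :=
      fun s hs => cs.isRightDescent_inv_iff.2 hs
    let σ : cs.ProperNerve := ⟨cs.leftDescentSet w, cs.exists_leftDescent_of_ne_one h1,
      cs.finite_parabolic_of_forall_isRightDescent hd⟩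
    have hl := cs.length_eq_add_of_forall_isRightDescent hd (inv_mem (cs.longest_mem σ))
    rw [← mul_inv_rev, length_inv, length_inv, length_inv] at hl
    have hpos := cs.length_longest_pos σ
    obtain ⟨α, hα, he⟩ := ih _ (by omega) (w := (cs.longest σ)⁻¹ * w) trivial rfl
    have hw : cs.longest σ * cs.nerveProd α = w := by rw [he, mul_inv_cancel_left]
    refine ⟨σ :: α, cs.cons_mem_greedyNormalForm.2 ⟨?_, hα⟩, ?_⟩
    · rw [hw]
    · rw [nerveProd_cons, hw]

theorem bijOn_nerveProd [Finite B] :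
    Set.BijOn cs.nerveProd cs.greedyNormalForm Set.univ :=
  ⟨fun _ _ => trivial, cs.injOn_nerveProd, cs.surjOn_nerveProd⟩

section Subst

variable {R : Type*} [Ring R] (ρ : W →* R) {i : B → I}

theorem constantCoeff_monomial_longest (σ : cs.ProperNerve) :
    MvPowerSeries.constantCoeff
      (MvPowerSeries.monomial (cs.growthExponent i (cs.longest σ)) (ρ (cs.longest σ))) = 0 := by
  rw [← MvPowerSeries.coeff_zero_eq_constantCoeff_apply]
  refine MvPowerSeries.coeff_monomial_ne (fun h => ?_) _
  have := cs.length_longest_pos σ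
  rw [← cs.degree_growthExponent (i := i), ← h, map_zero] at this
  exact lt_irrefl _ this

variable (hi : ∀ s s' : B, IsConj (cs.simple s) (cs.simple s') → i s = i s')
include hi

theorem prod_map_monomial_longest {α : List cs.ProperNerve} (hα : α ∈ cs.greedyNormalForm) :
    (α.map fun σ => MvPowerSeries.monomial (cs.growthExponent i (cs.longest σ))
      (ρ (cs.longest σ))).prod =
      MvPowerSeries.monomial (cs.growthExponent i (cs.nerveProd α)) (ρ (cs.nerveProd α)) := by
  induction α with
  | nil => simp [nerveProd, growthExponent_one]
  | cons σ α ih =>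
    obtain ⟨h1, h2⟩ := cs.cons_mem_greedyNormalForm.1 hα
    rw [List.map_cons, List.prod_cons, ih h2, MvPowerSeries.monomial_mul_monomial, nerveProd_cons,
      cs.growthExponent_mul hi (cs.length_longest_mul h1), map_mul ρ]

/-- Substitution maps the characteristic series of the greedy normal form to the growth series,
since every element of `W` is the product of exactly one word in normal form. -/
theorem subst_charSeries_greedyNormalForm [Finite B] [Algebra ℚ R] :
    NCPowerSeries.subst (fun σ => MvPowerSeries.monomial (cs.growthExponent i (cs.longest σ))
      (ρ (cs.longest σ))) (NCPowerSeries.charSeries cs.greedyNormalForm) =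
    MvPowerSeries.formalSum fun w : W =>
      MvPowerSeries.monomial (cs.growthExponent i w) (ρ w) := by
  classical
  ext n
  rw [NCPowerSeries.subst, MvPowerSeries.coeff_formalSum, MvPowerSeries.coeff_formalSum,
    ← finsum_mem_univ fun w => MvPowerSeries.coeff n
      (MvPowerSeries.monomial (cs.growthExponent i w) (ρ w)),
    ← finsum_mem_eq_of_bijOn cs.nerveProd cs.bijOn_nerveProd fun _ _ => rfl]
  refine finsum_congr fun α => ?_
  rw [finsum_eq_if]
  by_cases hα : α ∈ cs.greedyNormalForm
  · have h1 : NCPowerSeries.coeff α (NCPowerSeries.charSeries cs.greedyNormalForm) = 1 := if_pos hα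
    refine Eq.trans ?_ (if_pos hα).symm
    rw [h1, one_smul, cs.prod_map_monomial_longest ρ hi hα]
  · have h0 : NCPowerSeries.coeff α (NCPowerSeries.charSeries cs.greedyNormalForm) = 0 := if_neg hα
    refine Eq.trans ?_ (if_neg hα).symm
    rw [h0, zero_smul, map_zero]

theorem exists_algHom_subst [Finite B] [Algebra ℚ R] :
    ∃ φ : NCPowerSeries cs.ProperNerve →ₐ[ℚ] MvPowerSeries I R,
      (∀ l, φ l = NCPowerSeries.subst (fun σ =>
        MvPowerSeries.monomial (cs.growthExponent i (cs.longest σ)) (ρ (cs.longest σ))) l) ∧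
      (∀ σ, φ (NCPowerSeries.letter σ) =
        MvPowerSeries.monomial (cs.growthExponent i (cs.longest σ)) (ρ (cs.longest σ))) ∧
      φ (NCPowerSeries.charSeries cs.greedyNormalForm) =
        MvPowerSeries.formalSum fun w : W =>
          MvPowerSeries.monomial (cs.growthExponent i w) (ρ w) :=
  ⟨NCPowerSeries.substAlgHom (cs.constantCoeff_monomial_longest ρ), fun _ => rfl,
    fun σ => NCPowerSeries.subst_letter _ σ, cs.subst_charSeries_greedyNormalForm ρ hi⟩

theorem isRational_formalSum_monomial [Finite B] :
    (MvPowerSeries.formalSum fun w : W =>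
      MvPowerSeries.monomial (cs.growthExponent i w) (ρ w)).IsRational := by
  rw [formalSum_monomial_eq]
  exact cs.isRational_twistedGrowthSeries_univ ρ hi

end Subst

end CoxeterSystem

theorem mainTheorem5 {B W I : Type*} [Finite B] [Group W] {M : CoxeterMatrix B}
    (cs : CoxeterSystem M W) (i : B → I)
    (hi : ∀ s s' : B, IsConj (cs.simple s) (cs.simple s') → i s = i s') :
    (cs.growthSeries i).IsRational ∧
    (cs.completeGrowthSeries i).IsRational ∧
    (∃ φ : NCPowerSeries cs.ProperNerve →ₐ[ℚ] MvPowerSeries I ℚ,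
      (∀ l, φ l = NCPowerSeries.subst (fun σ => cs.growthMonomial i (cs.longest σ)) l) ∧
      (∀ σ, φ (NCPowerSeries.letter σ) = cs.growthMonomial i (cs.longest σ)) ∧
      φ (NCPowerSeries.charSeries cs.greedyNormalForm) = cs.growthSeries i) ∧
    (∃ φ : NCPowerSeries cs.ProperNerve →ₐ[ℚ] MvPowerSeries I (MonoidAlgebra ℚ W),
      (∀ l, φ l = NCPowerSeries.subst (fun σ => cs.completeGrowthMonomial i (cs.longest σ)) l) ∧
      (∀ σ, φ (NCPowerSeries.letter σ) = cs.completeGrowthMonomial i (cs.longest σ)) ∧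
      φ (NCPowerSeries.charSeries cs.greedyNormalForm) = cs.completeGrowthSeries i) :=
  -- The two series are the twists by the trivial and by the regular representation.
  ⟨cs.isRational_formalSum_monomial (1 : W →* ℚ) hi,
    cs.isRational_formalSum_monomial (MonoidAlgebra.of ℚ W) hi,
    cs.exists_algHom_subst (1 : W →* ℚ) hi,
    cs.exists_algHom_subst (MonoidAlgebra.of ℚ W) hi⟩
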